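/- An MV-algebra is an abelian monoid $(A,\oplus,0)$ with a unary operation $\neg$ such that $\neg\neg x=x$, $x\oplus\neg 0=\neg 0$ and $x\oplus\neg(x\oplus\neg y)=y\oplus\neg(y\oplus\neg x)$; the standard MV-algebra is $[0,1]$ with $x\oplus y=\min\{x+y,1\}$ and $\neg x=1-x$. Let $\mathsf{MV}$ be the category of MV-algebras and their homomorphisms. For a finite set $K$, a map $f\colon[0,1]^K\to[0,1]$ is piecewise linear with integer coefficients if it is continuous and there are finitely many affine maps $f_1,\dots,f_m\colon\mathbb{R}^K\to\mathbb{R}$ with integer coefficients (including the constant term) such that for every $x\in[0,1]^K$ there is an $i$ with $f(x)=f_i(x)$. For an arbitrary set $I$, a map $[0,1]^I\to[0,1]$ is piecewise linear with integer coefficients if it is the composite of the projection $[0,1]^I\to[0,1]^K$, for some finite $K\subseteq I$, with a piecewise linear map with integer coefficients on $[0,1]^K$. For $P\subseteq[0,1]^I$ and $Q\subseteq[0,1]^J$, a map $\eta\colon P\to Q$ is a $\mathbb{Z}$-map if for every $j\in J$ there is a piecewise linear map with integer coefficients $\xi_j\colon[0,1]^I\to[0,1]$ such that $\eta(p)_j=\xi_j(p)$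 for all $p\in P$. Let $\mathsf{T}$ be the category whose objects are the closed subspaces $X\subseteq[0,1]^I$ of Tychonoff cubes ($I$ any set, the cube being part of the object) and whose morphisms are the $\mathbb{Z}$-maps. For an MV-algebra $A$ let $W(A)=\mathrm{Hom}_{\mathsf{MV}}(A,[0,1])$, a closed subspace of $[0,1]^A$, and for a homomorphism $h\colon A\to B$ let $W(h)(g)=g\circ h$; this is a contravariant functor $W\colon\mathsf{MV}\to\mathsf{T}$. For $X\in\mathsf{T}$ let $\mathrm{McN}(X)=\mathsf{T}(X,[0,1])$, the set of $\mathbb{Z}$-maps $X\to[0,1]$, with the operations of the power $[0,1]^X$, and for $\eta\in\mathsf{T}(X,Y)$ and $\xi\in\mathrm{McN}(Y)$ let $\mathrm{McN}(\eta)(\xi)=\xi\circ\eta$. Then: 1. $\mathrm{McN}$ is a well-defined contravariant functor $\mathsf{T}\to\mathsf{MV}$; in particular each $\mathrm{McN}(X)$ is a subalgebra of $[0,1]^X$. 2. For each MV-algebra $A$, the map $\mathrm{ev}_A\colon A\to\mathrm{McN}(W(A))$, $(\mathrm{ev}_A(a))(f)=f(a)$, is a well-defined surjective homomorphism, and $A\mapsto\mathrm{ev}_A$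 is a natural transformation from $\mathrm{Id}_{\mathsf{MV}}$ to $\mathrm{McN}\circ W$. 3. For each $X\in\mathsf{T}$, the map $\mathrm{cev}_X\colon X\to W(\mathrm{McN}(X))$, $(\mathrm{cev}_X(x))(g)=g(x)$, is a well-defined $\mathbb{Z}$-map, and $X\mapsto\mathrm{cev}_X$ is a natural transformation from $\mathrm{Id}_{\mathsf{T}}$ to $W\circ\mathrm{McN}$. -/

import Mathlib

open CategoryTheory Opposite

universe u v w

namespace ZDuality

noncomputable section

/-! ### MV-algebras -/

/-- An MV-algebra: an abelian monoid `(A, ⊕, 0)` with a unary operation `¬` such that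
`¬¬x = x`, `x ⊕ ¬0 = ¬0` and `x ⊕ ¬(x ⊕ ¬y) = y ⊕ ¬(y ⊕ ¬x)`. -/
class MVAlgebra (A : Type u) where
  oplus : A → A → A
  zero : A
  neg : A → A
  oplus_assoc : ∀ x y z : A, oplus (oplus x y) z = oplus x (oplus y z)
  oplus_comm : ∀ x y : A, oplus x y = oplus y x
  oplus_zero : ∀ x : A, oplus x zero = x
  neg_neg : ∀ x : A, neg (neg x) = x
  oplus_neg_zero : ∀ x : A, oplus x (neg zero) = neg zero
  oplus_neg_oplus_neg : ∀ x y : A,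
    oplus x (neg (oplus x (neg y))) = oplus y (neg (oplus y (neg x)))

open MVAlgebra (oplus zero neg)

/-- Homomorphisms of MV-algebras. -/
structure IsMVHom {A : Type u} {B : Type v} [MVAlgebra A] [MVAlgebra B] (f : A → B) : Prop where
  map_zero : f zero = zero
  map_oplus : ∀ x y : A, f (oplus x y) = oplus (f x) (f y)
  map_neg : ∀ x : A, f (neg x) = neg (f x)

lemma IsMVHom.comp {A : Type u} {B : Type v} {C : Type w} [MVAlgebra A] [MVAlgebra B]
    [MVAlgebra C] {g : B → C} {f : A → B} (hg : IsMVHom g) (hf : IsMVHom f) :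
    IsMVHom (fun a => g (f a)) :=
  ⟨by rw [hf.map_zero, hg.map_zero], fun x y => by rw [hf.map_oplus, hg.map_oplus],
    fun x => by rw [hf.map_neg, hg.map_neg]⟩

/-- Subuniverses: subsets closed under the operations `0`, `⊕`, `¬`. -/
structure IsMVSubuniverse {A : Type u} [MVAlgebra A] (S : Set A) : Prop where
  zero_mem : zero ∈ S
  oplus_mem : ∀ x ∈ S, ∀ y ∈ S, oplus x y ∈ S
  neg_mem : ∀ x ∈ S, neg x ∈ S

/-- A subuniverse, with the restricted operations, is an MV-algebra. -/
abbrev IsMVSubuniverse.mvAlgebra {A : Type u} [MVAlgebra A] {S : Set A}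
    (hS : IsMVSubuniverse S) : MVAlgebra S where
  oplus x y := ⟨oplus x.1 y.1, hS.oplus_mem x.1 x.2 y.1 y.2⟩
  zero := ⟨zero, hS.zero_mem⟩
  neg x := ⟨neg x.1, hS.neg_mem x.1 x.2⟩
  oplus_assoc x y z := Subtype.ext (MVAlgebra.oplus_assoc x.1 y.1 z.1)
  oplus_comm x y := Subtype.ext (MVAlgebra.oplus_comm x.1 y.1)
  oplus_zero x := Subtype.ext (MVAlgebra.oplus_zero x.1)
  neg_neg x := Subtype.ext (MVAlgebra.neg_neg x.1)
  oplus_neg_zero x := Subtype.ext (MVAlgebra.oplus_neg_zero x.1)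
  oplus_neg_oplus_neg x y := Subtype.ext (MVAlgebra.oplus_neg_oplus_neg x.1 y.1)

/-- Powers of an MV-algebra, with pointwise operations. -/
instance instMVAlgebraPi (X : Type u) (A : Type v) [MVAlgebra A] : MVAlgebra (X → A) where
  oplus f g := fun x => oplus (f x) (g x)
  zero := fun _ => zero
  neg f := fun x => neg (f x)
  oplus_assoc f g h := funext fun x => MVAlgebra.oplus_assoc (f x) (g x) (h x)
  oplus_comm f g := funext fun x => MVAlgebra.oplus_comm (f x) (g x)
  oplus_zero f := funext fun x => MVAlgebra.oplus_zero (f x)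
  neg_neg f := funext fun x => MVAlgebra.neg_neg (f x)
  oplus_neg_zero f := funext fun x => MVAlgebra.oplus_neg_zero (f x)
  oplus_neg_oplus_neg f g := funext fun x => MVAlgebra.oplus_neg_oplus_neg (f x) (g x)

/-- The standard MV-algebra on `[0,1]`: `x ⊕ y = min (x + y) 1` and `¬x = 1 - x`. -/
instance instMVAlgebraUnitInterval : MVAlgebra unitInterval where
  oplus x y := ⟨min ((x : ℝ) + y) 1, le_min (add_nonneg x.2.1 y.2.1) zero_le_one, min_le_right _ _⟩
  zero := 0
  neg x := ⟨1 - (x : ℝ), sub_nonneg.2 x.2.2, sub_le_self 1 x.2.1⟩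
  oplus_assoc x y z := by
    have hx := x.2.1
    have hz := z.2.1
    apply Subtype.ext
    simp only [min_def]
    split_ifs <;> linarith
  oplus_comm x y := by
    apply Subtype.ext
    simp only [add_comm]
  oplus_zero x := by
    apply Subtype.ext
    simpa using x.2.2
  neg_neg x := by
    apply Subtype.ext
    simp
  oplus_neg_zero x := by
    have hx := x.2.1
    apply Subtype.ext
    simpa using hx
  oplus_neg_oplus_neg x y := by
    have hx := x.2
    have hy := y.2
    apply Subtype.ext
    simp only [min_def]
    split_ifs <;> linarith [hx.1, hx.2, hy.1, hy.2]

/-- The objects of the category of MV-algebras. -/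
structure MVCat : Type (u + 1) where
  carrier : Type u
  [str : MVAlgebra carrier]

attribute [instance] MVCat.str

/-- The morphisms of the category of MV-algebras. -/
@[ext]
structure MVCat.Hom (A B : MVCat.{u}) : Type u where
  toFun : A.carrier → B.carrier
  isMVHom : IsMVHom toFun

instance instCategoryMVCat : Category.{u} MVCat.{u} where
  Hom A B := MVCat.Hom A B
  id A := ⟨fun a => a, ⟨rfl, fun _ _ => rfl, fun _ => rfl⟩⟩
  comp f g := ⟨fun a => g.toFun (f.toFun a), g.isMVHom.comp f.isMVHom⟩

/-! ### Piecewise linear maps with integer coefficients and ℤ-maps -/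

/-- For a finite set `K`, the map `f : [0,1]^K → [0,1]` is piecewise linear with integer
coefficients: it is continuous, and there are finitely many affine maps with integer coefficients
`x ↦ b + ∑ k, a k * x k` (coded by the pairs `(b, a)`) such that at every point `f` agrees with
one of them. -/
def IsFinZPL {K : Type u} [Fintype K] (f : (K → unitInterval) → unitInterval) : Prop :=
  Continuous f ∧ ∃ F : Finset (ℤ × (K → ℤ)), ∀ x : K → unitInterval, ∃ c ∈ F,
    (f x : ℝ) = (c.1 : ℝ) + ∑ k, (c.2 k : ℝ) * (x k : ℝ)

/-- For an arbitrary set `I`, the map `ξ : [0,1]^I → [0,1]` is piecewise linear with integer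
coefficients if it factors through the projection to `[0,1]^S`, for some finite `S ⊆ I`, by a
piecewise linear map with integer coefficients on `[0,1]^S`. -/
def IsZPL {I : Type u} (ξ : (I → unitInterval) → unitInterval) : Prop :=
  ∃ (S : Finset I) (f : (S → unitInterval) → unitInterval), IsFinZPL f ∧
    ∀ p : I → unitInterval, ξ p = f (fun i : S => p i)

/-- ℤ-maps between subsets `P ⊆ [0,1]^I` and `Q ⊆ [0,1]^J`. -/
def IsZMap {I : Type u} {J : Type v} {P : Set (I → unitInterval)} {Q : Set (J → unitInterval)}
    (η : P → Q) : Prop :=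
  ∀ j : J, ∃ ξ : (I → unitInterval) → unitInterval, IsZPL ξ ∧ ∀ p : P, (η p).1 j = ξ p.1

lemma isZPL_proj {I : Type u} (i : I) :
    IsZPL (fun p : I → unitInterval => p i) := by
  refine ⟨{i}, fun x => x ⟨i, Finset.mem_singleton_self i⟩, ⟨continuous_apply _,
    {((0 : ℤ), fun _ => (1 : ℤ))}, fun x => ⟨_, Finset.mem_singleton_self _, ?_⟩⟩, fun p => rfl⟩
  simp only [Int.cast_zero, Int.cast_one, one_mul, zero_add]
  have : ∀ k : ({i} : Finset I), k = ⟨i, Finset.mem_singleton_self i⟩ :=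
    fun k => Subtype.ext (Finset.mem_singleton.1 k.2)
  rw [Finset.sum_eq_single_of_mem _ (Finset.mem_univ ⟨i, Finset.mem_singleton_self i⟩)]
  exact fun b _ hb => absurd (this b) hb

lemma IsFinZPL.reindex {K : Type u} {L : Type u} [Fintype K] [Fintype L]
    {f : (K → unitInterval) → unitInterval} (hf : IsFinZPL f) (σ : K → L) :
    IsFinZPL (fun x : L → unitInterval => f (fun k => x (σ k))) := by
  classical
  obtain ⟨hc, F, hF⟩ := hf
  refine ⟨hc.comp (continuous_pi fun k => continuous_apply _),
    F.image (fun c => (c.1, fun l => ∑ k, if σ k = l then c.2 k else 0)), fun x => ?_⟩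
  obtain ⟨c, hcF, h⟩ := hF (fun k => x (σ k))
  refine ⟨_, Finset.mem_image_of_mem _ hcF, ?_⟩
  rw [h]
  congr 1
  simp only [Int.cast_sum, Int.cast_ite, Int.cast_zero, Finset.sum_mul]
  rw [Finset.sum_comm]
  refine Finset.sum_congr rfl fun k _ => ?_
  simp [ite_mul]

lemma IsFinZPL.comp {K : Type u} {L : Type v} [Fintype K] [Fintype L]
    {f : (K → unitInterval) → unitInterval} (hf : IsFinZPL f)
    {g : K → (L → unitInterval) → unitInterval} (hg : ∀ k, IsFinZPL (g k)) :
    IsFinZPL (fun x : L → unitInterval => f (fun k => g k x)) := by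
  classical
  obtain ⟨hc, F, hF⟩ := hf
  choose hgc G hG using hg
  refine ⟨hc.comp (continuous_pi fun k => hgc k),
    (F ×ˢ Fintype.piFinset G).image (fun c => (c.1.1 + ∑ k, c.1.2 k * (c.2 k).1,
      fun l => ∑ k, c.1.2 k * (c.2 k).2 l)), fun x => ?_⟩
  obtain ⟨c, hcF, h⟩ := hF (fun k => g k x)
  choose d hd hd' using fun k => hG k x
  refine ⟨_, Finset.mem_image_of_mem _
    (Finset.mem_product.2 ⟨hcF, Fintype.mem_piFinset.2 hd⟩ : (c, d) ∈ _), ?_⟩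
  rw [h]
  simp only [hd']
  push_cast
  simp only [Finset.sum_mul, mul_add, Finset.sum_add_distrib, Finset.mul_sum]
  rw [Finset.sum_comm (γ := K), add_assoc]
  simp only [mul_assoc]

lemma IsZPL.comp {I J : Type u} {ξ : (J → unitInterval) → unitInterval} (hξ : IsZPL ξ)
    {ζ : J → (I → unitInterval) → unitInterval} (hζ : ∀ j, IsZPL (ζ j)) :
    IsZPL (fun p : I → unitInterval => ξ (fun j => ζ j p)) := by
  classical
  obtain ⟨S, f, hf, hξf⟩ := hξ
  choose T g hg hζg using hζ
  refine ⟨S.biUnion T, fun x => f (fun j => g j (fun i => x ⟨i.1,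
    Finset.mem_biUnion.2 ⟨j.1, j.2, i.2⟩⟩)), ?_, ?_⟩
  · exact hf.comp (fun j : S => (hg j).reindex (fun i : T j => (⟨i.1,
      Finset.mem_biUnion.2 ⟨j.1, j.2, i.2⟩⟩ : S.biUnion T)))
  · intro p
    simp only [hξf, hζg]

/-! ### Closed subspaces of Tychonoff cubes -/

/-- The objects of the category of closed subspaces `X` of the Tychonoff cubes `[0,1]^I`; the
index set `I` is part of the object. -/
structure TS : Type (u + 1) where
  index : Type u
  space : Set (index → unitInterval)
  isClosed : IsClosed space

/-- The morphisms of the category of closed subspaces of Tychonoff cubes: ℤ-maps. -/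
@[ext]
structure TS.Hom (X Y : TS.{u}) : Type u where
  toFun : X.space → Y.space
  isZMap : IsZMap toFun

instance instCategoryTS : Category.{u} TS.{u} where
  Hom X Y := TS.Hom X Y
  id X := ⟨fun x => x, fun i => ⟨_, isZPL_proj i, fun _ => rfl⟩⟩
  comp η θ := ⟨fun x => θ.toFun (η.toFun x), fun k => by
    obtain ⟨ξ, hξ, h⟩ := θ.isZMap k
    choose ζ hζ h' using η.isZMap
    refine ⟨_, hξ.comp hζ, fun p => ?_⟩
    rw [h]
    congr 1
    funext j
    exact h' j p⟩

/-- The space `[0,1]`, i.e. the whole cube `[0,1]^1`. -/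
def TS.interval : TS.{u} := ⟨PUnit.{u + 1}, Set.univ, isClosed_univ⟩

/-- The point of the space `[0,1]` given by a number `t` in `[0,1]`. -/
def TS.interval.mk (t : unitInterval) : TS.interval.{u}.space := ⟨fun _ => t, trivial⟩

/-! ### The functor `W` -/

lemma isClosed_setOf_isMVHom (A : Type u) [MVAlgebra A] :
    IsClosed {p : A → unitInterval | IsMVHom p} := by
  have key : {p : A → unitInterval | IsMVHom p} =
      {p | p zero = 0} ∩ (⋂ x : A, ⋂ y : A,
        {p | (p (oplus x y) : ℝ) = min ((p x : ℝ) + p y) 1}) ∩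
      (⋂ x : A, {p | (p (neg x) : ℝ) = 1 - (p x : ℝ)}) := by
    ext p
    simp only [Set.mem_ofPred_eq, Set.mem_inter_iff, Set.mem_iInter]
    exact ⟨fun h => ⟨⟨h.map_zero, fun x y => congrArg Subtype.val (h.map_oplus x y)⟩,
        fun x => congrArg Subtype.val (h.map_neg x)⟩,
      fun h => ⟨h.1.1, fun x y => Subtype.ext (h.1.2 x y), fun x => Subtype.ext (h.2 x)⟩⟩
  rw [key]
  refine ((isClosed_eq (continuous_apply _) continuous_const).inter
    (isClosed_iInter fun x => isClosed_iInter fun y => isClosed_eq ?_ ?_)).inter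
    (isClosed_iInter fun x => isClosed_eq ?_ ?_) <;> fun_prop

/-- `W(A) = Hom(A, [0,1])`, a closed subspace of `[0,1]^A`. -/
def WObj (A : MVCat.{u}) : TS.{u} :=
  ⟨A.carrier, {p | IsMVHom p}, isClosed_setOf_isMVHom A.carrier⟩

/-- The contravariant functor `W` from MV-algebras to closed subspaces of Tychonoff cubes:
`W(A) = Hom(A, [0,1])` and `W(h)(g) = g ∘ h`. -/
def W : MVCat.{u}ᵒᵖ ⥤ TS.{u} where
  obj A := WObj A.unop
  map {B A} h :=
    { toFun := fun g => ⟨fun a => g.1 (h.unop.toFun a), IsMVHom.comp g.2 h.unop.isMVHom⟩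
      isZMap := fun a => ⟨_, isZPL_proj (h.unop.toFun a), fun _ => rfl⟩ }

/-! ### The functor `McN` -/

/-- `McN(X)`: the set of all ℤ-maps `X → [0,1]`, as a subset of the power `[0,1]^X`. -/
def McNSet (X : TS.{u}) : Set (X.space → unitInterval) :=
  {f | IsZMap (fun x => TS.interval.mk.{u} (f x))}

/-- The assignment `X ↦ McN(X)`, `η ↦ (ξ ↦ ξ ∘ η)` is well defined: `McN(X)` is a subalgebra of
the MV-algebra `[0,1]^X`, and `ξ ∘ η` is in `McN(X)` whenever `η : X → Y` is a ℤ-map and `ξ` is in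
`McN(Y)`. -/
structure McNWellDefined : Prop where
  isMVSubuniverse : ∀ X : TS.{u}, IsMVSubuniverse (McNSet X)
  comp_mem : ∀ (X Y : TS.{u}) (η : X ⟶ Y), ∀ ξ ∈ McNSet Y, (fun x => ξ (η.toFun x)) ∈ McNSet X

/-- `McN(X)` as an MV-algebra, given that it is well defined. -/
def McNObj (hM : McNWellDefined.{u}) (X : TS.{u}) : MVCat.{u} :=
  { carrier := McNSet X
    str := (hM.isMVSubuniverse X).mvAlgebra }

/-- The contravariant functor `McN` from closed subspaces of Tychonoff cubes to MV-algebras, given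
that it is well defined. -/
def McN (hM : McNWellDefined.{u}) : TS.{u}ᵒᵖ ⥤ MVCat.{u} where
  obj X := McNObj hM X.unop
  map {Y X} η :=
    { toFun := fun ξ => (⟨fun x => ξ.1 (η.unop.toFun x),
        hM.comp_mem X.unop Y.unop η.unop ξ.1 ξ.2⟩ : McNSet X.unop)
      isMVHom := ⟨rfl, fun _ _ => rfl, fun _ => rfl⟩ }

end

end ZDuality

namespace ZDuality

open MVAlgebra (oplus zero neg)

/-! ### Operations of the standard MV-algebra and lattice operations -/

/-! Only surjectivity of `ev` is not formal; well-definedness and naturality follow because `IsZPL`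
maps compose and include the MV operations. A ℤ-map on `W(A)` is `f` applied to finitely many
evaluations, with `f` piecewise linear, and the evaluations form a subuniverse of a power of
`[0,1]`. So McNaughton's theorem, `IsMVSubuniverse.finZPL_mem`, suffices. It has two halves.
Truncated integer affine combinations of members stay in a subuniverse (`IsClippedMem.sum_int_mul`,
resting on the identity `clip_add`). And `f` is a max of mins of its truncated affine pieces
(`IsFinZPL.exists_sup_inf`), because for any two points some piece lies below `f` at the first and
above it at the second (`exists_affineEval_le_ge`). -/

lemma coe_oplus (x y : unitInterval) : ((oplus x y : unitInterval) : ℝ) = min ((x : ℝ) + y) 1 :=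
  rfl

lemma coe_neg (x : unitInterval) : ((neg x : unitInterval) : ℝ) = 1 - (x : ℝ) := rfl

/-- The negated inner sum is `max (y - x) 0`, and adding `x` gives the maximum. This makes joins
available in every subuniverse. -/
lemma oplus_neg_oplus_neg_eq_sup (x y : unitInterval) :
    oplus x (neg (oplus x (neg y))) = x ⊔ y := by
  have hx := x.2
  have hy := y.2
  rcases le_total x y with h | h
  · rw [sup_eq_right.2 h]
    have h' : (x : ℝ) ≤ y := h
    apply Subtype.ext
    simp only [coe_oplus, coe_neg, min_def]
    split_ifs <;> linarith [hx.1, hx.2, hy.1, hy.2]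
  · rw [sup_eq_left.2 h]
    have h' : (y : ℝ) ≤ x := h
    apply Subtype.ext
    simp only [coe_oplus, coe_neg, min_def]
    split_ifs <;> linarith [hx.1, hx.2, hy.1, hy.2]

lemma neg_sup_neg (x y : unitInterval) : neg (neg x ⊔ neg y) = x ⊓ y := by
  rcases le_total x y with h | h
  · have h' : neg y ≤ neg x := sub_le_sub_left (show (x : ℝ) ≤ y from h) 1
    rw [sup_eq_left.2 h', inf_eq_left.2 h, MVAlgebra.neg_neg]
  · have h' : neg x ≤ neg y := sub_le_sub_left (show (y : ℝ) ≤ x from h) 1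
    rw [sup_eq_right.2 h', inf_eq_right.2 h, MVAlgebra.neg_neg]

section Subuniverse

variable {X : Type u} {M : Set (X → unitInterval)}

lemma IsMVSubuniverse.sup_mem (hM : IsMVSubuniverse M) {f g : X → unitInterval} (hf : f ∈ M)
    (hg : g ∈ M) : f ⊔ g ∈ M := by
  have : f ⊔ g = oplus f (neg (oplus f (neg g))) :=
    funext fun x => (oplus_neg_oplus_neg_eq_sup (f x) (g x)).symm
  rw [this]
  exact hM.oplus_mem _ hf _ (hM.neg_mem _ (hM.oplus_mem _ hf _ (hM.neg_mem _ hg)))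

lemma IsMVSubuniverse.inf_mem (hM : IsMVSubuniverse M) {f g : X → unitInterval} (hf : f ∈ M)
    (hg : g ∈ M) : f ⊓ g ∈ M := by
  have : f ⊓ g = neg (neg f ⊔ neg g) := funext fun x => (neg_sup_neg (f x) (g x)).symm
  rw [this]
  exact hM.neg_mem _ (hM.sup_mem (hM.neg_mem _ hf) (hM.neg_mem _ hg))

lemma IsMVSubuniverse.bot_mem (hM : IsMVSubuniverse M) : (⊥ : X → unitInterval) ∈ M :=
  hM.zero_mem

lemma IsMVSubuniverse.top_mem (hM : IsMVSubuniverse M) : (⊤ : X → unitInterval) ∈ M := by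
  have : (⊤ : X → unitInterval) = neg zero :=
    funext fun x => Subtype.ext (sub_zero (1 : ℝ)).symm
  rw [this]
  exact hM.neg_mem _ hM.zero_mem

/-! ### Truncations of affine maps -/

/-- Truncation of a real number to the unit interval. -/
noncomputable def clip (r : ℝ) : unitInterval := Set.projIcc 0 1 zero_le_one r

lemma coe_clip (r : ℝ) : (clip r : ℝ) = max 0 (min 1 r) := rfl

lemma clip_coe (x : unitInterval) : clip x = x := Set.projIcc_val zero_le_one x

lemma clip_mono : Monotone clip := Set.monotone_projIcc zero_le_one

lemma neg_clip (r : ℝ) : neg (clip r) = clip (1 - r) := by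
  apply Subtype.ext
  simp only [coe_neg, coe_clip, min_def, max_def]
  split_ifs <;> linarith

/-- The right side is the Łukasiewicz product of `clip r ⊕ x` and `clip (r + 1)`. The second factor
is `1` for `r ≥ 0`; for `-1 ≤ r ≤ 0` the product is `max (x + r) 0`; for `r ≤ -1` it vanishes. -/
lemma clip_add (r : ℝ) (x : unitInterval) :
    clip (r + x) = neg (oplus (neg (oplus (clip r) x)) (neg (clip (r + 1)))) := by
  have hx := x.2
  apply Subtype.ext
  simp only [coe_neg, coe_oplus, coe_clip]
  rcases le_total r (-1) with h | h
  · rw [min_eq_right (by linarith [hx.1, hx.2] : r ≤ 1), max_eq_left (by linarith : r ≤ 0),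
      min_eq_right (by linarith : r + 1 ≤ 1), max_eq_left (by linarith : r + 1 ≤ 0),
      min_eq_right (by linarith [hx.2] : r + x ≤ 1), max_eq_left (by linarith [hx.2])]
    simp [hx.2]
  rcases le_total r 0 with h₀ | h₀
  · rw [min_eq_right (by linarith : r ≤ 1), max_eq_left h₀,
      min_eq_right (by linarith : r + 1 ≤ 1), max_eq_right (by linarith : 0 ≤ r + 1),
      min_eq_right (by linarith [hx.2] : r + x ≤ 1), zero_add, min_eq_left hx.2]
    simp only [min_def, max_def]
    split_ifs <;> linarith
  · rw [min_eq_left (by linarith : 1 ≤ r + 1), max_eq_right (zero_le_one : (0 : ℝ) ≤ 1)]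
    simp only [min_def, max_def]
    split_ifs <;> linarith [hx.1, hx.2]

/-- The real functions all of whose integer translates have their truncations in `M`. -/
def IsClippedMem (M : Set (X → unitInterval)) (h : X → ℝ) : Prop :=
  ∀ b : ℤ, (fun p => clip (b + h p)) ∈ M

namespace IsClippedMem

lemma zero (hM : IsMVSubuniverse M) : IsClippedMem M 0 := by
  intro b
  -- An integer truncates to `0` or `1`; this is where integrality of the constant term matters.
  rcases le_or_gt b 0 with hb | hb
  · convert hM.bot_mem using 1
    have hb' : (b : ℝ) ≤ 0 := by exact_mod_cast hb
    funext p
    refine (congrArg clip (add_zero _)).trans (Set.projIcc_of_le_left zero_le_one hb')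
  · convert hM.top_mem using 1
    have hb' : (1 : ℝ) ≤ b := by exact_mod_cast hb
    funext p
    refine (congrArg clip (add_zero _)).trans (Set.projIcc_of_right_le zero_le_one hb')

variable {h : X → ℝ}

lemma neg (hM : IsMVSubuniverse M) (hh : IsClippedMem M h) : IsClippedMem M (-h) := by
  intro b
  convert hM.neg_mem _ (hh (1 - b)) using 1
  funext p
  refine Eq.trans ?_ (neg_clip _).symm
  congr 1
  simp only [Pi.neg_apply]
  push_cast
  ring

/-- `clip_add` needs the translates by both `b` and `b + 1`, which is why `IsClippedMem` quantifies
over all integers. -/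
lemma add_coe (hM : IsMVSubuniverse M) (hh : IsClippedMem M h) {x : X → unitInterval}
    (hx : x ∈ M) : IsClippedMem M (fun p => h p + x p) := by
  intro b
  convert hM.neg_mem _ (hM.oplus_mem _ (hM.neg_mem _ (hM.oplus_mem _ (hh b) _ hx)) _
    (hM.neg_mem _ (hh (b + 1)))) using 1
  funext p
  have h₁ := clip_add (b + h p) (x p)
  rw [add_assoc, add_right_comm (b : ℝ) (h p) 1] at h₁
  simp only [Int.cast_add, Int.cast_one]
  exact h₁

lemma sub_coe (hM : IsMVSubuniverse M) (hh : IsClippedMem M h) {x : X → unitInterval}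
    (hx : x ∈ M) : IsClippedMem M (fun p => h p - x p) := by
  convert ((hh.neg hM).add_coe hM hx).neg hM using 1
  funext p
  simp only [Pi.neg_apply]
  ring

lemma add_int_mul (hM : IsMVSubuniverse M) (hh : IsClippedMem M h) {x : X → unitInterval}
    (hx : x ∈ M) (n : ℤ) : IsClippedMem M (fun p => h p + n * x p) := by
  induction n using Int.induction_on with
  | zero => simpa using hh
  | succ i ih =>
    convert ih.add_coe hM hx using 1
    funext p
    push_cast
    ring
  | pred i ih =>
    convert ih.sub_coe hM hx using 1
    funext p
    push_cast
    ring

lemma sum_int_mul (hM : IsMVSubuniverse M) {K : Type v} {x : K → X → unitInterval}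
    (hx : ∀ k, x k ∈ M) (a : K → ℤ) (s : Finset K) :
    IsClippedMem M (fun p => ∑ k ∈ s, (a k : ℝ) * (x k p : ℝ)) := by
  classical
  induction s using Finset.induction_on with
  | empty => exact zero hM
  | insert k s hk ih =>
    convert ih.add_int_mul hM (hx k) (a k) using 1
    funext p
    rw [Finset.sum_insert hk, add_comm]

end IsClippedMem

end Subuniverse

/-! ### Continuous selections of affine maps -/

/-- If every line with nonpositive intercept were negative at `1`, take the first point `t₀` where
`φ ≥ 0` lies on a line of positive intercept. All lines used before `t₀` are negative at `t₀`, so by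
continuity `φ t₀ < 0`, a contradiction. -/
lemma exists_affine_nonpos_nonneg {ι : Type u} (s : Finset ι) (a b : ι → ℝ)
    {φ : unitInterval → ℝ} (hφ : Continuous φ) (h0 : φ 0 = 0) (h1 : φ 1 = 0)
    (hs : ∀ t, ∃ i ∈ s, φ t = a i + t * b i) : ∃ i ∈ s, a i ≤ 0 ∧ 0 ≤ a i + b i := by
  by_contra! hcon
  have hclosed : ∀ i, IsClosed {t : unitInterval | φ t = a i + t * b i} := fun i =>
    isClosed_eq hφ (by fun_prop)
  obtain ⟨t₀, ht₀, hmin⟩ : ∃ t₀, IsLeast (⋃ i ∈ {i | i ∈ s ∧ 0 < a i},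
      {t : unitInterval | φ t = a i + t * b i} ∩ {t | 0 ≤ φ t}) t₀ := by
    refine IsCompact.exists_isLeast (IsClosed.isCompact ?_) ⟨1, ?_⟩
    · exact (s.finite_toSet.subset fun i hi => hi.1).isClosed_biUnion fun i _ =>
        (hclosed i).inter (isClosed_le continuous_const hφ)
    · obtain ⟨i, hi, hi'⟩ := hs 1
      have hval : a i + b i = 0 := by simpa [h1] using hi'.symm
      refine Set.mem_biUnion (x := i) ⟨hi, ?_⟩ ⟨hi', h1.ge⟩
      by_contra! hle
      linarith [hcon i hi hle]
  obtain ⟨j, ⟨-, hj0⟩, hj, hnonneg⟩ := Set.mem_iUnion₂.1 ht₀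
  have hpos : 0 < t₀ := by
    refine unitInterval.pos_iff_ne_zero.2 fun h => ?_
    have hj' : φ t₀ = a j + t₀ * b j := hj
    rw [h, h0] at hj'
    simp only [Set.Icc.coe_zero, zero_mul, add_zero] at hj'
    linarith
  have hpos' : (0 : ℝ) < t₀ := hpos
  have hsub : Set.Iio t₀ ⊆ ⋃ i ∈ {i | i ∈ s ∧ a i + t₀ * b i < 0},
      {t : unitInterval | φ t = a i + t * b i} := by
    intro t ht
    have ht' : (t : ℝ) < t₀ := ht
    obtain ⟨i, hi, hi'⟩ := hs t
    refine Set.mem_biUnion (x := i) ⟨hi, ?_⟩ hi'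
    -- A nonpositive intercept forces a negative value at `t₀` by interpolating between `0` and `1`.
    -- A positive one forces `φ t < 0` by minimality, so the line decreases and is still negative at
    -- `t₀`.
    rcases le_or_gt (a i) 0 with hai | hai
    · have h₁ := mul_nonpos_of_nonneg_of_nonpos (sub_nonneg.2 t₀.2.2) hai
      have h₂ := mul_neg_of_pos_of_neg hpos' (hcon i hi hai)
      linarith
    · have hneg : φ t < 0 := by
        by_contra! hge
        exact absurd (hmin (Set.mem_biUnion (x := i) ⟨hi, hai⟩ ⟨hi', hge⟩)) (not_le.2 ht)
      rw [hi'] at hneg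
      have hb : b i < 0 := by
        by_contra! hb
        linarith [mul_nonneg t.2.1 hb]
      linarith [mul_lt_mul_of_neg_right ht' hb]
  -- Finiteness of `s` makes the union closed, so it also contains the limit point `t₀`.
  have hcl := closure_minimal hsub
    ((s.finite_toSet.subset fun i hi => hi.1).isClosed_biUnion fun i _ => hclosed i)
  rw [closure_Iio' (a := t₀) ⟨0, hpos⟩] at hcl
  obtain ⟨i, ⟨-, hi⟩, hi'⟩ := Set.mem_iUnion₂.1 (hcl (Set.mem_Iic.2 le_rfl))
  have hi'' : φ t₀ = a i + t₀ * b i := hi'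
  have hnonneg' : 0 ≤ φ t₀ := hnonneg
  linarith

section Affine

variable {K : Type u}

/-- The point `(1 - t) x + t y` of a cube. -/
def cubeSegment (x y : K → unitInterval) (t : unitInterval) : K → unitInterval := fun k =>
  ⟨(1 - t) * x k + t * y k, convex_Icc (0 : ℝ) 1 (x k).2 (y k).2 (sub_nonneg.2 t.2.2) t.2.1
    (sub_add_cancel _ _)⟩

lemma continuous_cubeSegment (x y : K → unitInterval) : Continuous (cubeSegment x y) :=
  continuous_pi fun _ => Continuous.subtype_mk (by fun_prop) _

variable [Fintype K]

/-- The value at `x` of the affine map with integer coefficients `c`. -/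
noncomputable def affineEval (c : ℤ × (K → ℤ)) (x : K → unitInterval) : ℝ :=
  (c.1 : ℝ) + ∑ k, (c.2 k : ℝ) * (x k : ℝ)

lemma affineEval_cubeSegment (c : ℤ × (K → ℤ)) (x y : K → unitInterval) (t : unitInterval) :
    affineEval c (cubeSegment x y t) = (1 - t) * affineEval c x + t * affineEval c y := by
  simp only [affineEval, cubeSegment, mul_add, Finset.mul_sum, Finset.sum_add_distrib]
  have h₁ : ∀ k, (c.2 k : ℝ) * ((1 - t) * (x k : ℝ)) = (1 - t) * (c.2 k * x k) :=
    fun k => by ring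
  have h₂ : ∀ k, (c.2 k : ℝ) * (t * (y k : ℝ)) = t * (c.2 k * y k) := fun k => by ring
  simp only [h₁, h₂]
  ring

lemma exists_affineEval_le_ge {f : (K → unitInterval) → unitInterval} (hf : Continuous f)
    {F : Finset (ℤ × (K → ℤ))} (hF : ∀ x, ∃ c ∈ F, (f x : ℝ) = affineEval c x)
    (x y : K → unitInterval) :
    ∃ c ∈ F, affineEval c x ≤ f x ∧ (f y : ℝ) ≤ affineEval c y := by
  have hx : cubeSegment x y 0 = x := funext fun k => Subtype.ext (by simp [cubeSegment])
  have hy : cubeSegment x y 1 = y := funext fun k => Subtype.ext (by simp [cubeSegment])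
  -- Restrict to the segment from `x` to `y` and subtract the chord of `f`, so that both endpoint
  -- values vanish.
  obtain ⟨c, hc, h₁, h₂⟩ := exists_affine_nonpos_nonneg F
    (fun c => affineEval c x - f x)
    (fun c => (affineEval c y - f y) - (affineEval c x - f x))
    (φ := fun t => f (cubeSegment x y t) - ((1 - t) * f x + t * f y))
    (by
      have := continuous_cubeSegment x y
      fun_prop)
    (by simp [hx]) (by simp [hy])
    (fun t => by
      obtain ⟨c, hc, h⟩ := hF (cubeSegment x y t)
      refine ⟨c, hc, ?_⟩
      simp only [h, affineEval_cubeSegment]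
      ring)
  exact ⟨c, hc, by linarith, by linarith⟩

/-- A piecewise linear map is a finite supremum of finite infima of truncated affine maps. -/
lemma IsFinZPL.exists_sup_inf {f : (K → unitInterval) → unitInterval} (hf : IsFinZPL f) :
    ∃ 𝒮 : Finset (Finset (ℤ × (K → ℤ))),
      ∀ x, f x = 𝒮.sup fun S => S.inf fun c => clip (affineEval c x) := by
  classical
  obtain ⟨hc, F, hF⟩ := hf
  -- For each `y`, take the pieces lying above `f` at `y`; only finitely many such sets arise as `y`
  -- varies.
  refine ⟨F.powerset.filter fun S => ∃ y, S = F.filter fun c => (f y : ℝ) ≤ affineEval c y,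
    fun x => le_antisymm ?_ (Finset.sup_le fun S hS => ?_)⟩
  · refine le_trans ?_ (Finset.le_sup (b := F.filter fun c => (f x : ℝ) ≤ affineEval c x)
      (Finset.mem_filter.2 ⟨Finset.mem_powerset.2 (Finset.filter_subset _ _), x, rfl⟩))
    refine Finset.le_inf fun c hcx => ?_
    rw [← clip_coe (f x)]
    exact clip_mono (Finset.mem_filter.1 hcx).2
  · obtain ⟨-, y, rfl⟩ := Finset.mem_filter.1 hS
    obtain ⟨c, hcF, h₁, h₂⟩ := exists_affineEval_le_ge hc hF x y
    refine (Finset.inf_le (Finset.mem_filter.2 ⟨hcF, h₂⟩)).trans ?_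
    rw [← clip_coe (f x)]
    exact clip_mono h₁

/-- McNaughton's theorem: a subuniverse of a power of `[0,1]` is closed under all piecewise linear
maps with integer coefficients. -/
theorem IsMVSubuniverse.finZPL_mem {X : Type v} {M : Set (X → unitInterval)}
    (hM : IsMVSubuniverse M) {f : (K → unitInterval) → unitInterval} (hf : IsFinZPL f)
    {x : K → X → unitInterval} (hx : ∀ k, x k ∈ M) : (fun p => f (fun k => x k p)) ∈ M := by
  obtain ⟨𝒮, h𝒮⟩ := hf.exists_sup_inf
  have key : (fun p => f (fun k => x k p)) =
      𝒮.sup fun S => S.inf fun c p => clip (affineEval c fun k => x k p) := by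
    funext p
    simp only [h𝒮, Finset.sup_apply, Finset.inf_apply]
  rw [key]
  exact Finset.sup_induction hM.bot_mem (fun _ h₁ _ h₂ => hM.sup_mem h₁ h₂) fun S _ =>
    Finset.inf_induction hM.top_mem (fun _ h₁ _ h₂ => hM.inf_mem h₁ h₂) fun c _ =>
      IsClippedMem.sum_int_mul hM hx c.2 Finset.univ c.1

end Affine

/-! ### The functors and the unit maps -/

lemma isFinZPL_zero {K : Type u} [Fintype K] :
    IsFinZPL (fun _ : K → unitInterval => zero) :=
  ⟨continuous_const, {(0, 0)}, fun _ => ⟨_, Finset.mem_singleton_self _,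
    by simp [show (zero : unitInterval) = 0 from rfl]⟩⟩

lemma isFinZPL_neg {K : Type u} [Fintype K] (k : K) :
    IsFinZPL (fun x : K → unitInterval => neg (x k)) := by
  classical
  refine ⟨Continuous.subtype_mk (by fun_prop) _, {(1, Pi.single k (-1))},
    fun x => ⟨_, Finset.mem_singleton_self _, ?_⟩⟩
  simp [coe_neg, Pi.single_apply, sub_eq_add_neg]

lemma isFinZPL_oplus {K : Type u} [Fintype K] (k l : K) :
    IsFinZPL (fun x : K → unitInterval => oplus (x k) (x l)) := by
  classical
  refine ⟨Continuous.subtype_mk (by fun_prop) _, {(0, Pi.single k 1 + Pi.single l 1), (1, 0)},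
    fun x => ?_⟩
  rw [coe_oplus]
  rcases le_total ((x k : ℝ) + x l) 1 with h | h
  · refine ⟨_, Finset.mem_insert_self _ _, ?_⟩
    simp [min_eq_left h, Pi.single_apply, add_mul, Finset.sum_add_distrib]
  · refine ⟨(1, 0), by simp, ?_⟩
    simp [min_eq_right h]

lemma IsFinZPL.isZPL {K : Type u} [Fintype K] {f : (K → unitInterval) → unitInterval}
    (hf : IsFinZPL f) : IsZPL f :=
  ⟨Finset.univ, fun x => f fun k => x ⟨k, Finset.mem_univ k⟩,
    hf.reindex fun k => (⟨k, Finset.mem_univ k⟩ : (Finset.univ : Finset K)), fun _ => rfl⟩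

lemma mem_McNSet_iff {X : TS.{u}} {f : X.space → unitInterval} :
    f ∈ McNSet X ↔ ∃ ξ, IsZPL ξ ∧ ∀ p : X.space, f p = ξ p.1 :=
  ⟨fun h => h PUnit.unit, fun h _ => h⟩

lemma isMVSubuniverse_McNSet (X : TS.{u}) : IsMVSubuniverse (McNSet X) where
  zero_mem := mem_McNSet_iff.2 ⟨fun _ => zero, ⟨∅, fun _ => zero, isFinZPL_zero, fun _ => rfl⟩,
    fun _ => rfl⟩
  oplus_mem f hf g hg := by
    obtain ⟨ξ, hξ, h⟩ := mem_McNSet_iff.1 hf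
    obtain ⟨ζ, hζ, h'⟩ := mem_McNSet_iff.1 hg
    -- A lifted two-element type indexes the arguments, since `IsZPL.comp` wants both index types in
    -- one universe.
    refine mem_McNSet_iff.2 ⟨_, (isFinZPL_oplus (ULift.up.{u} true) (ULift.up false)).isZPL.comp
      (ζ := fun b => if b.down then ξ else ζ) (fun b => ?_), fun p => ?_⟩
    · split_ifs
      exacts [hξ, hζ]
    · exact congrArg₂ oplus (h p) (h' p)
  neg_mem f hf := by
    obtain ⟨ξ, hξ, h⟩ := mem_McNSet_iff.1 hf
    exact mem_McNSet_iff.2 ⟨_, (isFinZPL_neg PUnit.unit.{u + 1}).isZPL.comp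
      (ζ := fun _ => ξ) (fun _ => hξ), fun p => congrArg neg (h p)⟩

lemma mcNWellDefined : McNWellDefined.{u} where
  isMVSubuniverse := isMVSubuniverse_McNSet
  comp_mem X Y η ξ hξ := by
    obtain ⟨ζ, hζ, h⟩ := mem_McNSet_iff.1 hξ
    choose θ hθ h' using η.isZMap
    exact mem_McNSet_iff.2 ⟨_, hζ.comp hθ, fun p =>
      (h _).trans (congrArg ζ (funext fun j => h' j p))⟩

lemma eval_mem_McNSet (A : MVCat.{u}) (a : A.carrier) :
    (fun f : (WObj A).space => f.1 a) ∈ McNSet (WObj A) :=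
  mem_McNSet_iff.2 ⟨_, isZPL_proj a, fun _ => rfl⟩

lemma isMVSubuniverse_range_eval (A : MVCat.{u}) :
    IsMVSubuniverse (Set.range fun (a : A.carrier) (f : (WObj A).space) => f.1 a) where
  zero_mem := ⟨zero, funext fun f => f.2.map_zero⟩
  oplus_mem := by
    rintro _ ⟨a, rfl⟩ _ ⟨b, rfl⟩
    exact ⟨oplus a b, funext fun f => f.2.map_oplus a b⟩
  neg_mem := by
    rintro _ ⟨a, rfl⟩
    exact ⟨neg a, funext fun f => f.2.map_neg a⟩

lemma exists_eval_eq (A : MVCat.{u}) {g : (WObj A).space → unitInterval}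
    (hg : g ∈ McNSet (WObj A)) : ∃ a : A.carrier, ∀ f : (WObj A).space, f.1 a = g f := by
  obtain ⟨ξ, ⟨S, f, hf, hξ⟩, h⟩ := mem_McNSet_iff.1 hg
  obtain ⟨a, ha⟩ := (isMVSubuniverse_range_eval A).finZPL_mem hf
    (x := fun (i : S) p => p.1 i.1) (fun i => ⟨i.1, rfl⟩)
  exact ⟨a, fun p => (congrFun ha p).trans ((hξ _).symm.trans (h p).symm)⟩

/-- The natural transformation with components `a ↦ (f ↦ f a)`. -/
noncomputable def evNatTrans (hM : McNWellDefined.{u}) : 𝟭 MVCat.{u} ⟶ W.{u}.rightOp ⋙ McN hM where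
  app A :=
    { toFun := fun a => (⟨fun f => f.1 a, eval_mem_McNSet A a⟩ : McNSet (WObj A))
      isMVHom := ⟨Subtype.ext (funext fun f => f.2.map_zero),
        fun a b => Subtype.ext (funext fun f => f.2.map_oplus a b),
        fun a => Subtype.ext (funext fun f => f.2.map_neg a)⟩ }
  naturality _ _ _ := rfl

/-- The natural transformation with components `x ↦ (g ↦ g x)`. -/
noncomputable def cevNatTrans (hM : McNWellDefined.{u}) :
    𝟭 TS.{u} ⟶ (McN hM).rightOp ⋙ W.{u} where
  app X :=
    { toFun := fun x => (⟨fun g : McNSet X => g.1 x, ⟨rfl, fun _ _ => rfl, fun _ => rfl⟩⟩ :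
        (WObj (McNObj hM X)).space)
      -- The coordinate of `cev` at `g` is `g` itself, which is the restriction of a piecewise
      -- linear map.
      isZMap := fun g => mem_McNSet_iff.1 (show McNSet X from g).2 }
  naturality _ _ _ := rfl

end ZDuality

theorem mainTheorem4 :
    ∃ hM : ZDuality.McNWellDefined.{u},
      (∃ ev : 𝟭 ZDuality.MVCat.{u} ⟶ ZDuality.W.{u}.rightOp ⋙ ZDuality.McN hM,
        (∀ (A : ZDuality.MVCat.{u}) (a : A.carrier) (f : (ZDuality.WObj A).space),
          ((ev.app A).toFun a : ZDuality.McNSet (ZDuality.WObj A)).1 f = f.1 a) ∧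
        ∀ A : ZDuality.MVCat.{u}, Function.Surjective (ev.app A).toFun) ∧
      (∃ cev : 𝟭 ZDuality.TS.{u} ⟶ (ZDuality.McN hM).rightOp ⋙ ZDuality.W.{u},
        ∀ (X : ZDuality.TS.{u}) (x : X.space) (g : ZDuality.McNSet X),
          ((cev.app X).toFun x : (ZDuality.WObj (ZDuality.McNObj hM X)).space).1 g = g.1 x) := by
  refine ⟨ZDuality.mcNWellDefined, ⟨ZDuality.evNatTrans _, fun _ _ _ => rfl, fun A g => ?_⟩,
    ZDuality.cevNatTrans _, fun _ _ _ => rfl⟩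
  obtain ⟨a, ha⟩ := ZDuality.exists_eval_eq A (show ZDuality.McNSet (ZDuality.WObj A) from g).2
  exact ⟨a, Subtype.ext (funext ha)⟩
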